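/- Let $\lambda,\mu_1,\mu_2>0$ satisfy $\lambda+\mu_1+\mu_2=1$, $\lambda<\mu_1$, $\lambda<\mu_2$ and $\mu_1\neq\mu_2$, and set $\rho_i=\lambda/\mu_i$ for $i=1,2$. Let $I_1,I_2,\dots$ be independent, identically distributed random vectors in $\mathbb Z^2$ with $$P(I_k=(1,0))=\lambda,\qquad P(I_k=(-1,1))=\mu_1,\qquad P(I_k=(0,-1))=\mu_2 .$$ Let $X$ be the constrained random walk on $\mathbb Z_+^2$ (two queues in tandem) that starts at a given $X_0\in\mathbb Z_+^2$ and moves from $X_k$ to $X_k+v$, where $v$ is the next unused increment, if $X_k+v\in\mathbb Z_+^2$, and stays at $X_k$ otherwise. Write $P_z$ for the probability when $X_0=z$. For $n\ge 1$ let $$\tau_n=\inf\{k\ge 0: X_k(1)+X_k(2)=n\},\qquad \tau_0=\inf\{k\ge 0: X_k=(0,0)\},$$ with $\inf\emptyset=\infty$. Put $\gamma=-(\log\rho_1\vee\log\rho_2)$, $\mathbf r_1=-\gamma\,(1,0)$, $\mathbf r_3=\log(\rho_2)\,(1,1)$ and $$V(x)=\bigl(-\log\rho_1+\langle \mathbf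 r_1,x\rangle\bigr)\wedge\bigl(-\log\rho_2+\langle \mathbf r_3,x\rangle\bigr),\qquad x\in\mathbb R^2 .$$ Then for every $x\in\mathbb R_+^2$ with $0<x(1)+x(2)<1$, with $x_n=\lfloor nx\rfloor=(\lfloor nx(1)\rfloor,\lfloor nx(2)\rfloor)$, $$\lim_{n\to\infty}-\frac1n\log P_{x_n}(\tau_n<\tau_0)=V(x).$$ -/

import Mathlib

open MeasureTheory ProbabilityTheory Filter Topology

namespace TandemQueue

noncomputable section

/-- The law of one increment: `(1,0)`, `(-1,1)`, `(0,-1)` have probabilities `lam`, `m₁`, `m₂`. -/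
def stepLaw (lam m₁ m₂ : ℝ) : Measure (Fin 2 → ℤ) :=
  ENNReal.ofReal lam • Measure.dirac ![1, 0]
    + ENNReal.ofReal m₁ • Measure.dirac ![-1, 1]
    + ENNReal.ofReal m₂ • Measure.dirac ![0, -1]

/-- The constraining map: the increment `v` is suppressed at `x` if `x + v` leaves the
nonnegative quadrant of `ℤ²`. -/
def constrain (x v : Fin 2 → ℤ) : Fin 2 → ℤ :=
  if ∀ i, 0 ≤ (x + v) i then v else 0

/-- The constrained random walk with initial position `x` driven by the increments `I`. -/
def walk {Ω : Type*} (I : ℕ → Ω → (Fin 2 → ℤ)) (x : Fin 2 → ℤ) : ℕ → Ω → (Fin 2 → ℤ)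
  | 0, _ => x
  | k + 1, ω => walk I x k ω + constrain (walk I x k ω) (I k ω)

/-- The exit boundary `{x ∈ ℤ₊² : x(1) + x(2) = n}`. -/
def exitBoundary (n : ℕ) : Set (Fin 2 → ℤ) :=
  {z | (∀ i, 0 ≤ z i) ∧ z 0 + z 1 = n}

/-- The first time `k ≥ 0` at which the walk started at `x` is on the exit boundary
(`⊤` if this never happens). -/
def exitTime {Ω : Type*} (I : ℕ → Ω → (Fin 2 → ℤ)) (x : Fin 2 → ℤ) (n : ℕ) : Ω → WithTop ℕ :=
  hittingAfter (walk I x) (exitBoundary n) 0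

/-- The first time `k ≥ 0` at which the walk started at `x` is at the origin
(`⊤` if this never happens). -/
def emptyTime {Ω : Type*} (I : ℕ → Ω → (Fin 2 → ℤ)) (x : Fin 2 → ℤ) : Ω → WithTop ℕ :=
  hittingAfter (walk I x) {0} 0

/-- The componentwise integer part `⌊n x⌋`. -/
def scaledStart (n : ℕ) (x : EuclideanSpace ℝ (Fin 2)) : Fin 2 → ℤ :=
  fun i => ⌊(n : ℝ) * x i⌋

/-- `γ = -(log ρ₁ ∨ log ρ₂)` -/
def gam (ρ₁ ρ₂ : ℝ) : ℝ := -(max (Real.log ρ₁) (Real.log ρ₂))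

/-- `r₁ = -γ (1, 0)` -/
def r₁ (ρ₁ ρ₂ : ℝ) : EuclideanSpace ℝ (Fin 2) := (-gam ρ₁ ρ₂) • !₂[1, 0]

/-- `r₃ = log ρ₂ (1, 1)` -/
def r₃ (ρ₂ : ℝ) : EuclideanSpace ℝ (Fin 2) := Real.log ρ₂ • !₂[1, 1]

/-- `V(x) = (-log ρ₁ + ⟨r₁, x⟩) ∧ (-log ρ₂ + ⟨r₃, x⟩)` -/
def rate (ρ₁ ρ₂ : ℝ) (x : EuclideanSpace ℝ (Fin 2)) : ℝ :=
  min (-Real.log ρ₁ + inner ℝ (r₁ ρ₁ ρ₂) x) (-Real.log ρ₂ + inner ℝ (r₃ ρ₂) x)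

end

end TandemQueue

/-! Write `rᵢ = μᵢ / λ = 1 / ρᵢ`, and let `p(a, b)` be the probability that the walk from `(a, b)`
reaches the line `a + b = n` before the origin. Then `p` is harmonic for the transition operator
between the origin and that line, it is `0` at the origin and `1` on the line. The claim follows
from showing that, up to a constant factor below and a factor of order `n ^ 2` above, `p(a, b)` is
`max (r₂ ^ (a + b - n)) (r₁ ^ (a - n))`: such factors disappear under `(1 / n) log`, and the
exponential rate of the maximum is `V`.

Lower bound (`exists_mul_expBound_le_exitProb`). The functions `r₂ ^ (a + b)` and `r₁ ^ a` are
harmonic in the interior and have a nonnegative defect on one axis each, hence are subharmonic.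
Subtracting `1` and rescaling puts them below `p` at the origin and on the exit line, and the
maximum principle does the rest.

Upper bound (`exists_exitProb_le_mul_expBound`). The defect of `r₂ ^ (a + b)` on `b = 0` is
cancelled by a multiple `c = (μ₂ - λ) / (μ₁ - μ₂)` of `r₂ ^ (a + b) / r₁ ^ b`; this is where `μ₁ ≠
μ₂` enters. Subtracting a multiple of `r₁ ^ a` keeps the correction nonnegative and bounds it
suitably on `a = 0`. The defect left on `a = 0` is at most a constant times `max (r₂ ^ (-n)) (r₁ ^
(-n))`, and a Lyapunov function of quadratic growth with drift at most `-1` absorbs it. -/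

namespace TandemQueue

/-! ### Reduction to an event on increment sequences -/

/-- The sequences of increments for which the walk from `x` reaches the exit boundary before the
origin. -/
def exitFirst (n : ℕ) (x : Fin 2 → ℤ) : Set (ℕ → Fin 2 → ℤ) :=
  {s | ∃ k, walk (fun i (s : ℕ → Fin 2 → ℤ) => s i) x k s ∈ exitBoundary n ∧
    ∀ j ≤ k, walk (fun i (s : ℕ → Fin 2 → ℤ) => s i) x j s ≠ 0}

/-- Prepend an increment to a sequence of increments. -/
def consSeq (v : Fin 2 → ℤ) (s : ℕ → Fin 2 → ℤ) : ℕ → Fin 2 → ℤ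
  | 0 => v
  | k + 1 => s k

theorem walk_eq_coord {Ω : Type*} (I : ℕ → Ω → (Fin 2 → ℤ)) (x : Fin 2 → ℤ) (k : ℕ) (ω : Ω) :
    walk I x k ω = walk (fun i (s : ℕ → Fin 2 → ℤ) => s i) x k (fun i => I i ω) := by
  induction k with
  | zero => rfl
  | succ k ih => simp only [walk, ih]

theorem walk_consSeq (x v : Fin 2 → ℤ) (s : ℕ → Fin 2 → ℤ) (k : ℕ) :
    walk (fun i (s : ℕ → Fin 2 → ℤ) => s i) x (k + 1) (consSeq v s)
      = walk (fun i (s : ℕ → Fin 2 → ℤ) => s i) (x + constrain x v) k s := by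
  induction k with
  | zero => rfl
  | succ k ih => rw [walk, ih]; rfl

theorem exitTime_lt_emptyTime_iff {Ω : Type*} (I : ℕ → Ω → (Fin 2 → ℤ)) (n : ℕ)
    (x : Fin 2 → ℤ) (ω : Ω) :
    exitTime I x n ω < emptyTime I x ω ↔ (fun i => I i ω) ∈ exitFirst n x := by
  simp only [exitFirst, Set.mem_ofPred_eq, ← walk_eq_coord]
  constructor
  · intro h
    have hne : exitTime I x n ω ≠ ⊤ := ne_top_of_lt h
    obtain ⟨k, hk⟩ := WithTop.ne_top_iff_exists.1 hne
    refine ⟨k, ?_, fun j hj h0 => ?_⟩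
    · have := hittingAfter_mem_set_of_ne_top hne
      unfold exitTime at hk
      rw [← hk] at this
      exact this
    · have h1 : emptyTime I x ω ≤ (j : ℕ) :=
        hittingAfter_le_of_mem (Nat.zero_le j) (by simpa using h0)
      have h2 : ((j : ℕ) : WithTop ℕ) ≤ (k : ℕ) := by exact_mod_cast hj
      rw [← hk] at h
      exact absurd (h1.trans h2) (not_le.2 h)
  · rintro ⟨k, hk, h0⟩
    have h1 : exitTime I x n ω ≤ (k : ℕ) := hittingAfter_le_of_mem (Nat.zero_le k) hk
    refine h1.trans_lt (lt_of_not_ge fun h => ?_)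
    obtain ⟨j, hj, hj0⟩ := (hittingAfter_le_iff (u := walk I x) (s := {0}) (n := 0)).1 h
    exact h0 j hj.2 (by simpa using hj0)

theorem measurable_walk (x : Fin 2 → ℤ) (k : ℕ) :
    Measurable (walk (fun i (s : ℕ → Fin 2 → ℤ) => s i) x k) := by
  induction k with
  | zero => exact measurable_const
  | succ k ih =>
    have h : Measurable fun p : (Fin 2 → ℤ) × (Fin 2 → ℤ) => p.1 + constrain p.1 p.2 :=
      Measurable.of_discrete
    exact h.comp (ih.prodMk (measurable_pi_apply k))

theorem measurableSet_exitFirst (n : ℕ) (x : Fin 2 → ℤ) : MeasurableSet (exitFirst n x) := by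
  have : exitFirst n x = ⋃ k, (walk (fun i (s : ℕ → Fin 2 → ℤ) => s i) x k ⁻¹' exitBoundary n ∩
      ⋂ j, ⋂ (_ : j ≤ k), walk (fun i (s : ℕ → Fin 2 → ℤ) => s i) x j ⁻¹' {0}ᶜ) := by
    ext s
    simp [exitFirst]
  rw [this]
  refine MeasurableSet.iUnion fun k => (measurable_walk x k (.of_discrete)).inter ?_
  exact MeasurableSet.iInter fun j => MeasurableSet.iInter fun _ =>
    measurable_walk x j (.of_discrete)

theorem isProbabilityMeasure_stepLaw {lam m₁ m₂ : ℝ} (h0 : 0 ≤ lam) (h1 : 0 ≤ m₁) (h2 : 0 ≤ m₂)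
    (hsum : lam + m₁ + m₂ = 1) : IsProbabilityMeasure (stepLaw lam m₁ m₂) := by
  refine ⟨?_⟩
  simp only [stepLaw, Measure.add_apply, Measure.smul_apply, measure_univ, smul_eq_mul, mul_one]
  rw [← ENNReal.ofReal_add h0 h1, ← ENNReal.ofReal_add (by positivity) h2, hsum]
  simp

theorem lintegral_stepLaw (lam m₁ m₂ : ℝ) (f : (Fin 2 → ℤ) → ENNReal) :
    ∫⁻ v, f v ∂(stepLaw lam m₁ m₂) = ENNReal.ofReal lam * f ![1, 0]
      + ENNReal.ofReal m₁ * f ![-1, 1] + ENNReal.ofReal m₂ * f ![0, -1] := by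
  simp [stepLaw, lintegral_add_measure, lintegral_smul_measure]

/-! ### First-step analysis -/

theorem measurable_consSeq : Measurable fun p : (Fin 2 → ℤ) × (ℕ → Fin 2 → ℤ) =>
    consSeq p.1 p.2 := by
  refine measurable_pi_iff.2 fun i => ?_
  cases i with
  | zero => exact measurable_fst
  | succ i => exact (measurable_pi_apply i).comp measurable_snd

/-- An infinite product measure is determined by finite boxes, and the preimage of a box under
prepending is a product of the condition on coordinate `0` with a shifted box. This is the Markov
property in the form needed to condition on the first increment. -/
theorem map_consSeq_infinitePi (μ : Measure (Fin 2 → ℤ)) [IsProbabilityMeasure μ] :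
    (μ.prod (Measure.infinitePi fun _ : ℕ => μ)).map (fun p => consSeq p.1 p.2)
      = Measure.infinitePi fun _ : ℕ => μ := by
  refine Measure.eq_infinitePi _ fun s t ht => ?_
  have hs : Set.InjOn Nat.succ (Nat.succ ⁻¹' (s : Set ℕ)) := Nat.succ_injective.injOn
  have hset : (fun p : (Fin 2 → ℤ) × (ℕ → Fin 2 → ℤ) => consSeq p.1 p.2) ⁻¹' ((s : Set ℕ).pi t)
      = (if 0 ∈ s then t 0 else Set.univ) ×ˢ
        ((s.preimage Nat.succ hs : Finset ℕ) : Set ℕ).pi (fun i => t (i + 1)) := by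
    ext ⟨v, r⟩
    simp only [Set.mem_preimage, Set.mem_pi, Set.mem_prod, Finset.mem_coe, Finset.mem_preimage]
    constructor
    · intro h
      refine ⟨?_, fun i hi => h _ hi⟩
      split_ifs with h0
      · exact h 0 h0
      · trivial
    · rintro ⟨h0, h1⟩ i hi
      cases i with
      | zero => rwa [if_pos hi] at h0
      | succ i => exact h1 i hi
  rw [Measure.map_apply measurable_consSeq
    (MeasurableSet.pi s.countable_toSet fun i _ => ht i), hset, Measure.prod_prod,
    Measure.infinitePi_pi _ (fun i _ => ht (i + 1))]
  have h1 : ∏ i ∈ s.preimage Nat.succ hs, μ (t (i + 1)) = ∏ i ∈ s with i ≠ 0, μ (t i) := by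
    refine Finset.prod_bij (fun i _ => i + 1) (fun i hi => by simpa using hi)
      (fun i _ j _ h => by simpa using h) (fun i hi => ?_) (fun i _ => rfl)
    obtain ⟨hi, h0⟩ := Finset.mem_filter.1 hi
    exact ⟨i - 1, by simpa [Nat.sub_add_cancel (Nat.one_le_iff_ne_zero.2 h0)] using hi,
      Nat.sub_add_cancel (Nat.one_le_iff_ne_zero.2 h0)⟩
  rw [h1]
  split_ifs with h0
  · rw [← Finset.mul_prod_erase s _ h0]
    congr 2
    ext i
    simp [and_comm]
  · rw [measure_univ, one_mul]
    congr 1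
    exact Finset.filter_true_of_mem fun i hi h => h0 (h ▸ hi)

theorem consSeq_mem_exitFirst_iff {n : ℕ} {x : Fin 2 → ℤ} (hx : x ≠ 0) (hxn : x ∉ exitBoundary n)
    (v : Fin 2 → ℤ) (s : ℕ → Fin 2 → ℤ) :
    consSeq v s ∈ exitFirst n x ↔ s ∈ exitFirst n (x + constrain x v) := by
  constructor
  · rintro ⟨k, hk, h0⟩
    cases k with
    | zero => exact absurd hk hxn
    | succ k =>
      refine ⟨k, by rwa [walk_consSeq] at hk, fun j hj => ?_⟩
      have := h0 (j + 1) (by omega)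
      rwa [walk_consSeq] at this
  · rintro ⟨k, hk, h0⟩
    refine ⟨k + 1, by rwa [walk_consSeq], fun j hj => ?_⟩
    cases j with
    | zero => exact hx
    | succ j => rw [walk_consSeq]; exact h0 j (by omega)

/-- The probability, under the law of the increments, that the walk from `x` reaches the exit
boundary before the origin. -/
noncomputable def exitProb (lam m₁ m₂ : ℝ) (n : ℕ) (x : Fin 2 → ℤ) : ℝ :=
  (Measure.infinitePi fun _ : ℕ => stepLaw lam m₁ m₂).real (exitFirst n x)

theorem measureReal_exitTime_lt_emptyTime {lam m₁ m₂ : ℝ}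
    {Ω : Type*} [MeasurableSpace Ω] (P : Measure Ω) {I : ℕ → Ω → (Fin 2 → ℤ)}
    (hindep : iIndepFun I P) (hlaw : ∀ k, HasLaw (I k) (stepLaw lam m₁ m₂) P)
    (n : ℕ) (x : Fin 2 → ℤ) :
    P.real {ω | exitTime I x n ω < emptyTime I x ω} = exitProb lam m₁ m₂ n x := by
  have hm : AEMeasurable (fun ω i => I i ω) P := aemeasurable_pi_iff.2 fun i => (hlaw i).aemeasurable
  have h := hindep.hasLaw_infinitePi hlaw hm
  simp only [exitTime_lt_emptyTime_iff I n]
  rw [exitProb, measureReal_def, measureReal_def, ← h.map_eq,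
    Measure.map_apply_of_aemeasurable hm (measurableSet_exitFirst n x)]
  rfl

theorem exitProb_eq_add {lam m₁ m₂ : ℝ} (h0 : 0 ≤ lam) (h1 : 0 ≤ m₁) (h2 : 0 ≤ m₂)
    (hsum : lam + m₁ + m₂ = 1) {n : ℕ} {x : Fin 2 → ℤ} (hx : x ≠ 0) (hxn : x ∉ exitBoundary n) :
    exitProb lam m₁ m₂ n x = lam * exitProb lam m₁ m₂ n (x + constrain x ![1, 0])
      + m₁ * exitProb lam m₁ m₂ n (x + constrain x ![-1, 1])
      + m₂ * exitProb lam m₁ m₂ n (x + constrain x ![0, -1]) := by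
  have := isProbabilityMeasure_stepLaw h0 h1 h2 hsum
  have key : (Measure.infinitePi fun _ : ℕ => stepLaw lam m₁ m₂) (exitFirst n x)
      = ∫⁻ v, (Measure.infinitePi fun _ : ℕ => stepLaw lam m₁ m₂)
          (exitFirst n (x + constrain x v)) ∂(stepLaw lam m₁ m₂) := by
    conv_lhs => rw [← map_consSeq_infinitePi]
    rw [Measure.map_apply measurable_consSeq (measurableSet_exitFirst n x),
      Measure.prod_apply (measurable_consSeq (measurableSet_exitFirst n x))]
    refine lintegral_congr fun v => congrArg _ ?_
    ext s
    exact consSeq_mem_exitFirst_iff hx hxn v s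
  simp only [exitProb, measureReal_def]
  rw [key, lintegral_stepLaw, ENNReal.toReal_add, ENNReal.toReal_add]
  · simp only [ENNReal.toReal_mul, ENNReal.toReal_ofReal h0, ENNReal.toReal_ofReal h1,
      ENNReal.toReal_ofReal h2]
  all_goals finiteness

theorem exitProb_zero {lam m₁ m₂ : ℝ} (n : ℕ) : exitProb lam m₁ m₂ n 0 = 0 := by
  have : exitFirst n 0 = ∅ := by
    refine Set.eq_empty_iff_forall_notMem.2 ?_
    rintro s ⟨k, -, h⟩
    exact h 0 (Nat.zero_le k) rfl
  simp [exitProb, this]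

theorem exitProb_of_mem_exitBoundary {lam m₁ m₂ : ℝ} (h0 : 0 ≤ lam) (h1 : 0 ≤ m₁) (h2 : 0 ≤ m₂)
    (hsum : lam + m₁ + m₂ = 1) {n : ℕ} {x : Fin 2 → ℤ} (hx : x ≠ 0) (hxn : x ∈ exitBoundary n) :
    exitProb lam m₁ m₂ n x = 1 := by
  have := isProbabilityMeasure_stepLaw h0 h1 h2 hsum
  have : exitFirst n x = Set.univ := by
    refine Set.eq_univ_of_forall fun s => ⟨0, hxn, fun j hj => ?_⟩
    obtain rfl := Nat.le_zero.1 hj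
    exact hx
  simp [exitProb, this]

/-! ### The harmonic equation on the lattice quadrant -/

/-- The transition operator of the constrained walk, acting on functions on `ℕ × ℕ`. -/
noncomputable def transition (lam m₁ m₂ : ℝ) (f : ℕ → ℕ → ℝ) (a b : ℕ) : ℝ :=
  lam * f (a + 1) b + m₁ * (if a = 0 then f a b else f (a - 1) (b + 1))
    + m₂ * (if b = 0 then f a b else f a (b - 1))

theorem exitProb_eq_transition {lam m₁ m₂ : ℝ} (h0 : 0 ≤ lam) (h1 : 0 ≤ m₁) (h2 : 0 ≤ m₂)
    (hsum : lam + m₁ + m₂ = 1) {n a b : ℕ} (hab : a + b ≠ 0) (hn : a + b < n) :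
    exitProb lam m₁ m₂ n ![a, b]
      = transition lam m₁ m₂ (fun a b => exitProb lam m₁ m₂ n ![a, b]) a b := by
  have hx : (![(a : ℤ), b] : Fin 2 → ℤ) ≠ 0 := fun h => hab <| by
    have ha := congrFun h 0
    have hb := congrFun h 1
    simp at ha hb
    omega
  have hxn : (![(a : ℤ), b] : Fin 2 → ℤ) ∉ exitBoundary n := by
    rintro ⟨-, h⟩
    simp at h
    omega
  rw [exitProb_eq_add h0 h1 h2 hsum hx hxn, transition]
  have e1 : (![(a : ℤ), b] : Fin 2 → ℤ) + constrain ![(a : ℤ), b] ![1, 0]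
      = ![((a + 1 : ℕ) : ℤ), b] := by
    rw [constrain, if_pos]
    · ext i; fin_cases i <;> simp
    · simp [Fin.forall_fin_two]; omega
  have e2 : (![(a : ℤ), b] : Fin 2 → ℤ) + constrain ![(a : ℤ), b] ![-1, 1]
      = if a = 0 then ![(a : ℤ), b] else ![((a - 1 : ℕ) : ℤ), ((b + 1 : ℕ) : ℤ)] := by
    rcases Nat.eq_zero_or_pos a with rfl | ha
    · rw [constrain, if_neg] <;> simp [Fin.forall_fin_two]
    · rw [constrain, if_pos, if_neg ha.ne']
      · ext i; fin_cases i <;> simp; omega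
      · simp [Fin.forall_fin_two]; omega
  have e3 : (![(a : ℤ), b] : Fin 2 → ℤ) + constrain ![(a : ℤ), b] ![0, -1]
      = if b = 0 then ![(a : ℤ), b] else ![(a : ℤ), ((b - 1 : ℕ) : ℤ)] := by
    rcases Nat.eq_zero_or_pos b with rfl | hb
    · rw [constrain, if_neg] <;> simp [Fin.forall_fin_two]
    · rw [constrain, if_pos, if_neg hb.ne']
      · ext i; fin_cases i <;> simp; omega
      · simp [Fin.forall_fin_two]; omega
  rw [e1, e2, e3]
  split_ifs <;> rfl

theorem exitProb_eq_one {lam m₁ m₂ : ℝ} (h0 : 0 ≤ lam) (h1 : 0 ≤ m₁) (h2 : 0 ≤ m₂)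
    (hsum : lam + m₁ + m₂ = 1) {n a b : ℕ} (hab : a + b ≠ 0) (hn : a + b = n) :
    exitProb lam m₁ m₂ n ![a, b] = 1 := by
  refine exitProb_of_mem_exitBoundary h0 h1 h2 hsum (fun h => hab ?_) ⟨?_, ?_⟩
  · have ha := congrFun h 0
    have hb := congrFun h 1
    simp at ha hb
    omega
  · simp [Fin.forall_fin_two]
  · simp; omega

/-! ### Lyapunov function and maximum principle -/

theorem transition_mono_at {lam m₁ m₂ : ℝ} (h0 : 0 ≤ lam) (h1 : 0 ≤ m₁) (h2 : 0 ≤ m₂)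
    (hsum : lam + m₁ + m₂ = 1) {f : ℕ → ℕ → ℝ} {n a b : ℕ} {c : ℝ} (hn : a + b < n)
    (hf : ∀ a b, a + b ≤ n → f a b ≤ c) : transition lam m₁ m₂ f a b ≤ c := by
  have e1 := hf (a + 1) b (by omega)
  have e2 : (if a = 0 then f a b else f (a - 1) (b + 1)) ≤ c := by
    split_ifs
    · exact hf _ _ (by omega)
    · exact hf _ _ (by omega)
  have e3 : (if b = 0 then f a b else f a (b - 1)) ≤ c := by
    split_ifs
    · exact hf _ _ (by omega)
    · exact hf _ _ (by omega)
  calc transition lam m₁ m₂ f a b ≤ lam * c + m₁ * c + m₂ * c := by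
        unfold transition; gcongr
    _ = c := by rw [← add_mul, ← add_mul, hsum, one_mul]

/-- Off the axis `b = 0` the total `a + b` has drift `λ - μ₂ < 0`, so its square decreases on
average when large. On `b = 0` the total has drift `λ > 0`, and the term `a ^ 2` compensates: its
drift is about `-2 (μ₁ - λ) a`, while `c` is chosen so that the loss `2 c λ a` is only half of that.
-/
theorem transition_quadratic_le {lam m₁ m₂ c : ℝ} (hlam : 0 < lam) (hm₁ : lam < m₁)
    (hm₂ : lam < m₂) (hsum : lam + m₁ + m₂ = 1) (hc : c = (m₁ - lam) / (2 * lam)) (a b : ℕ) :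
    transition lam m₁ m₂ (fun a b => c * ((a : ℝ) + b) ^ 2 + (a : ℝ) ^ 2) a b
      ≤ c * ((a : ℝ) + b) ^ 2 + (a : ℝ) ^ 2 + (c * (lam + m₂) + (m₁ - lam) + lam + m₁)
        - min (m₁ - lam) (2 * c * (m₂ - lam)) * ((a : ℝ) + b) := by
  have hd1 : 0 < m₁ - lam := by linarith
  have hd2 : 0 < m₂ - lam := by linarith
  have hc0 : 0 < c := by rw [hc]; positivity
  have hcl : 2 * (c * lam) = m₁ - lam := by rw [hc]; field_simp
  have hm : m₂ = 1 - lam - m₁ := by linarith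
  have hδ1 := min_le_left (m₁ - lam) (2 * c * (m₂ - lam))
  have hδ2 := min_le_right (m₁ - lam) (2 * c * (m₂ - lam))
  set δ := min (m₁ - lam) (2 * c * (m₂ - lam))
  have hcm : 0 < c * m₂ := by apply mul_pos hc0; linarith
  have hcl0 : 0 < c * lam := by positivity
  have key : ∀ S : ℝ, 0 ≤ S → δ * S ≤ 2 * c * (m₂ - lam) * S := fun S hS => by gcongr
  have key1 : ∀ S : ℝ, 0 ≤ S → δ * S ≤ (m₁ - lam) * S := fun S hS => by gcongr
  rcases a with _ | a <;> rcases b with _ | b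
  · simp [transition]
    nlinarith
  · have := key (b + 1) (by positivity)
    simp [transition]
    subst hm
    nlinarith
  · have := key1 (a + 1) (by positivity)
    have ha : (0 : ℝ) ≤ (m₁ - lam) * a := by positivity
    have : c * lam * (2 * a + 3) = (m₁ - lam) * (a + 3 / 2) := by linear_combination (a + 3/2) * hcl
    simp [transition]
    subst hm
    nlinarith
  · have := key (a + 1 + (b + 1)) (by positivity)
    have ha : (0 : ℝ) ≤ (m₁ - lam) * a := by positivity
    simp [transition]
    subst hm
    nlinarith

/-- Every service lowers `2 a + b` by one and so doubles the power, while an arrival divides it by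
four. Away from the origin at least one queue can be served, and each service rate exceeds `λ`. -/
theorem transition_half_pow_ge {lam m₁ m₂ : ℝ} (hlam : 0 < lam) (hm₁ : lam < m₁)
    (hm₂ : lam < m₂) (hsum : lam + m₁ + m₂ = 1) {a b : ℕ} (hab : a + b ≠ 0) :
    (1 + lam / 4) * (1 / 2 : ℝ) ^ (2 * a + b)
      ≤ transition lam m₁ m₂ (fun a b => (1 / 2 : ℝ) ^ (2 * a + b)) a b := by
  have hp : 0 < (1 / 2 : ℝ) ^ (2 * a + b) := by positivity
  have hm : m₂ = 1 - lam - m₁ := by linarith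
  rcases a with _ | a <;> rcases b with _ | b
  · simp at hab
  · simp only [transition, Nat.add_sub_cancel, if_true, Nat.succ_ne_zero, if_false]
    have : 0 < (1 / 2 : ℝ) ^ b := by positivity
    ring_nf at this ⊢
    subst hm
    nlinarith
  · simp only [transition, Nat.add_sub_cancel, if_true, Nat.succ_ne_zero, if_false]
    have : 0 < (1 / 2 : ℝ) ^ (a * 2) := by positivity
    ring_nf at this ⊢
    subst hm
    nlinarith
  · simp only [transition, Nat.add_sub_cancel, Nat.succ_ne_zero, if_false]
    have : 0 < (1 / 2 : ℝ) ^ (a * 2) * (1 / 2 : ℝ) ^ b := by positivity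
    ring_nf at this ⊢
    subst hm
    nlinarith

/-- The quadratic has negative drift only far from the origin. Adding a large multiple of the
bounded function `1 - (1 / 2) ^ (2 a + b)`, whose drift is strictly negative at every point but the
origin, repairs the finitely many remaining points without changing the quadratic growth. -/
theorem exists_lyapunov {lam m₁ m₂ : ℝ} (hlam : 0 < lam) (hm₁ : lam < m₁)
    (hm₂ : lam < m₂) (hsum : lam + m₁ + m₂ = 1) :
    ∃ G : ℕ → ℕ → ℝ, ∃ K : ℝ, 0 < K ∧ (∀ a b, 0 ≤ G a b) ∧
      (∀ a b, a + b ≠ 0 → transition lam m₁ m₂ G a b + 1 ≤ G a b) ∧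
      ∀ n a b : ℕ, n ≠ 0 → a + b ≤ n → G a b ≤ K * (n : ℝ) ^ 2 := by
  obtain ⟨c, hc⟩ : ∃ c, c = (m₁ - lam) / (2 * lam) := ⟨_, rfl⟩
  have hd1 : 0 < m₁ - lam := by linarith
  have hd2 : 0 < m₂ - lam := by linarith
  have hc0 : 0 < c := by rw [hc]; positivity
  have hQ := transition_quadratic_le hlam hm₁ hm₂ hsum hc
  have hδ : 0 < min (m₁ - lam) (2 * c * (m₂ - lam)) := lt_min hd1 (by positivity)
  have hC : 0 < c * (lam + m₂) + (m₁ - lam) + lam + m₁ := by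
    have : 0 < lam + m₂ := by linarith
    have : 0 < c * (lam + m₂) := by positivity
    linarith
  set δ := min (m₁ - lam) (2 * c * (m₂ - lam))
  set C := c * (lam + m₂) + (m₁ - lam) + lam + m₁
  obtain ⟨N, hN⟩ := exists_nat_ge ((C + 1) / δ)
  -- Chosen so that `M * (λ / 4) * (1 / 2) ^ (2 N) = C + 1`; for `a + b < N` the exponent `2 a + b`
  -- is at most `2 N`.
  set M : ℝ := 4 * (C + 1) / lam * 2 ^ (2 * N)
  have hM : 0 < M := by positivity
  refine ⟨fun a b => (c * ((a : ℝ) + b) ^ 2 + (a : ℝ) ^ 2) + M * (1 - (1 / 2) ^ (2 * a + b)),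
    c + 1 + M, by positivity, fun a b => ?_, fun a b hab => ?_, fun n a b hn hab => ?_⟩
  · have : (1 / 2 : ℝ) ^ (2 * a + b) ≤ 1 := pow_le_one₀ (by norm_num) (by norm_num)
    have : 0 ≤ 1 - (1 / 2 : ℝ) ^ (2 * a + b) := by linarith
    positivity
  · have h1 := hQ a b
    have h2 := transition_half_pow_ge hlam hm₁ hm₂ hsum hab
    have h3 : transition lam m₁ m₂ (fun a b : ℕ =>
        (c * ((a : ℝ) + b) ^ 2 + (a : ℝ) ^ 2) + M * (1 - (1 / 2) ^ (2 * a + b))) a b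
        = transition lam m₁ m₂ (fun a b => c * ((a : ℝ) + b) ^ 2 + (a : ℝ) ^ 2) a b
        + M * (1 - transition lam m₁ m₂ (fun a b => (1 / 2 : ℝ) ^ (2 * a + b)) a b) := by
      simp only [transition]
      split_ifs <;> linear_combination M * hsum
    rw [h3]
    have h4 : C + 1 ≤ δ * (a + b) + M * (lam / 4 * (1 / 2) ^ (2 * a + b)) := by
      rcases le_or_gt N (a + b) with h | h
      · have : (C + 1) / δ ≤ a + b := hN.trans (by exact_mod_cast h)
        rw [div_le_iff₀ hδ] at this
        have : 0 ≤ M * (lam / 4 * (1 / 2) ^ (2 * a + b)) := by positivity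
        linarith
      · have h5 : (1 / 2 : ℝ) ^ (2 * N) ≤ (1 / 2) ^ (2 * a + b) :=
          pow_le_pow_of_le_one (by norm_num) (by norm_num) (by omega)
        have h6 : M * (lam / 4 * (1 / 2) ^ (2 * N)) = C + 1 := by
          simp only [M, one_div, inv_pow]
          field_simp
        have h7 : 0 ≤ δ * (a + b) := by positivity
        have h8 : M * (lam / 4 * (1 / 2) ^ (2 * N)) ≤ M * (lam / 4 * (1 / 2) ^ (2 * a + b)) := by
          gcongr
        linarith
    have h9 := mul_le_mul_of_nonneg_left h2 hM.le
    linarith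
  · have h1 : (1 : ℝ) ≤ n := by exact_mod_cast Nat.one_le_iff_ne_zero.2 hn
    have h2 : (a : ℝ) + b ≤ n := by exact_mod_cast hab
    have h3 : (a : ℝ) ≤ n := by exact_mod_cast (by omega : a ≤ n)
    have h4 : 0 ≤ (1 / 2 : ℝ) ^ (2 * a + b) := by positivity
    have h5 : M * (1 - (1 / 2 : ℝ) ^ (2 * a + b)) ≤ M * n ^ 2 := by
      gcongr
      nlinarith
    have h6 : c * ((a : ℝ) + b) ^ 2 ≤ c * n ^ 2 := by gcongr
    have h7 : (a : ℝ) ^ 2 ≤ n ^ 2 := by gcongr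
    simp only
    linarith

/-- Perturbing by `ε * G`, with `G` the Lyapunov function, makes the inequality strict, so an
interior maximum is excluded without any connectivity argument; then `ε` is taken small. -/
theorem le_of_subharmonic_of_superharmonic {lam m₁ m₂ : ℝ} (hlam : 0 < lam) (hm₁ : lam < m₁)
    (hm₂ : lam < m₂) (hsum : lam + m₁ + m₂ = 1) {f g : ℕ → ℕ → ℝ} {n : ℕ}
    (hf : ∀ a b, a + b ≠ 0 → a + b < n → f a b ≤ transition lam m₁ m₂ f a b)
    (hg : ∀ a b, a + b ≠ 0 → a + b < n → transition lam m₁ m₂ g a b ≤ g a b)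
    (h0 : f 0 0 ≤ g 0 0) (hn : ∀ a b, a + b = n → f a b ≤ g a b) {a b : ℕ} (hab : a + b ≤ n) :
    f a b ≤ g a b := by
  obtain ⟨G, K, -, hG0, hG, -⟩ := exists_lyapunov hlam hm₁ hm₂ hsum
  have key : ∀ ε > 0, f a b ≤ g a b + ε * G a b := by
    intro ε hε
    set F : ℕ → ℕ → ℝ := fun a b => f a b - g a b - ε * G a b with hF
    suffices F a b ≤ 0 by simp only [hF] at this; linarith
    set T : Finset (ℕ × ℕ) := (Finset.range (n + 1) ×ˢ Finset.range (n + 1)).filter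
      fun p => p.1 + p.2 ≤ n
    have hT : ∀ p : ℕ × ℕ, p ∈ T ↔ p.1 + p.2 ≤ n := fun p => by simp [T]; omega
    obtain ⟨⟨i, j⟩, hij, hmax⟩ := T.exists_max_image (fun p => F p.1 p.2) ⟨(a, b), (hT _).2 hab⟩
    have hmax' : ∀ a b, a + b ≤ n → F a b ≤ F i j := fun a b h => hmax (a, b) ((hT _).2 h)
    refine (hmax' a b hab).trans ?_
    rw [hT] at hij
    have hGp := mul_nonneg hε.le (hG0 i j)
    by_cases hz : i + j = 0
    · obtain ⟨rfl, rfl⟩ : i = 0 ∧ j = 0 := by omega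
      simp only [hF]
      linarith
    rcases hij.eq_or_lt with he | hlt
    · have := hn i j he
      simp only [hF]
      linarith
    · exfalso
      -- At a maximum, averaging cannot increase `F`; but the drift of `-ε * G` forces the average
      -- to be at least `F i j + ε`.
      have h1 := transition_mono_at hlam.le (by linarith) (by linarith) hsum hlt hmax'
      have h2 : transition lam m₁ m₂ F i j = transition lam m₁ m₂ f i j
          - transition lam m₁ m₂ g i j - ε * transition lam m₁ m₂ G i j := by
        simp only [transition, hF]
        split_ifs <;> ring
      have h3 := hf i j hz hlt
      have h4 := hg i j hz hlt
      have h5 := mul_le_mul_of_nonneg_left (hG i j hz) hε.le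
      rw [h2] at h1
      simp only [hF] at h1
      linarith
  by_contra! h
  have hGp := hG0 a b
  -- This `ε` makes `ε * G a b` less than half of `f a b - g a b`; the `+ 1` covers `G a b = 0`.
  have := key ((f a b - g a b) / (2 * (G a b + 1))) (by
    apply div_pos <;> linarith)
  rw [div_mul_eq_mul_div, ← sub_le_iff_le_add', le_div_iff₀ (by linarith)] at this
  nlinarith

/-! ### Exponentials harmonic in the interior and their defects on the axes -/

section Harmonic

variable {lam m₁ m₂ r₁ r₂ : ℝ}

theorem transition_pow_add (h₂ : m₂ = r₂ * lam)
    (hsum : lam + m₁ + m₂ = 1) (a b : ℕ) :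
    transition lam m₁ m₂ (fun a b => r₂ ^ (a + b)) a b
      = r₂ ^ (a + b) + if b = 0 then (m₂ - lam) * r₂ ^ (a + b) else 0 := by
  have h₁ : m₁ = 1 - lam - m₂ := by linarith
  subst h₁ h₂
  rcases a with _ | a <;> rcases b with _ | b <;> simp [transition] <;> ring

theorem transition_pow_left (h₁ : m₁ = r₁ * lam)
    (hsum : lam + m₁ + m₂ = 1) (a b : ℕ) :
    transition lam m₁ m₂ (fun a _ => r₁ ^ a) a b
      = r₁ ^ a + if a = 0 then (m₁ - lam) * r₁ ^ a else 0 := by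
  have h₂ : m₂ = 1 - lam - m₁ := by linarith
  subst h₂ h₁
  rcases a with _ | a <;> rcases b with _ | b <;> simp [transition] <;> ring

/-- On `b = 0` this function equals `r₂ ^ (a + b)` and its defect is again a multiple of that power,
so a combination of the two is exactly harmonic there. The price is a new defect on `a = 0`. -/
theorem transition_pow_mul_div_pow (hr₁ : 0 < r₁) (h₁ : m₁ = r₁ * lam) (h₂ : m₂ = r₂ * lam)
    (hsum : lam + m₁ + m₂ = 1) {a b : ℕ} (hab : a + b ≠ 0) :
    transition lam m₁ m₂ (fun a b => r₂ ^ (a + b) / r₁ ^ b) a b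
      = r₂ ^ (a + b) / r₁ ^ b + (if a = 0 then (m₁ - lam) * (r₂ ^ (a + b) / r₁ ^ b) else 0)
        + if b = 0 then (m₂ - m₁) * (r₂ ^ (a + b) / r₁ ^ b) else 0 := by
  subst h₁ h₂
  rcases a with _ | a <;> rcases b with _ | b
  · simp at hab
  · simp [transition]
    field_simp
    linear_combination r₂ * r₂ ^ b * r₁ ^ b * hsum
  · simp [transition]
    field_simp
    linear_combination r₂ * r₂ ^ a * hsum
  · simp [transition]
    field_simp
    linear_combination r₂ ^ 2 * r₂ ^ a * r₂ ^ b * r₁ ^ 2 * r₁ ^ (b * 2) * hsum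

end Harmonic

/-! ### Two-sided bounds on the exit probability -/

/-- The larger of the two exponentials `ρ₂ ^ (n - a - b)` and `ρ₁ ^ (n - a)`, with `rᵢ = 1 / ρᵢ`. -/
noncomputable def expBound (r₁ r₂ : ℝ) (n a b : ℕ) : ℝ :=
  max (r₂ ^ (a + b) / r₂ ^ n) (r₁ ^ a / r₁ ^ n)

theorem pow_div_pow_le_one {r : ℝ} (hr : 1 < r) {k n : ℕ} (h : k ≤ n) : r ^ k / r ^ n ≤ 1 :=
  div_le_one_of_le₀ (pow_le_pow_right₀ hr.le h) (by positivity)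

theorem pow_sub_one_ge {r : ℝ} (hr : 1 < r) {k : ℕ} (hk : k ≠ 0) :
    (1 - 1 / r) * r ^ k ≤ r ^ k - 1 := by
  have h1 : r ≤ r ^ k := le_self_pow₀ hr.le hk
  have h2 : 1 ≤ r ^ k / r := by rwa [le_div_iff₀ (by linarith), one_mul]
  have h3 : (1 - 1 / r) * r ^ k = r ^ k - r ^ k / r := by ring
  linarith

section Bounds

variable {lam m₁ m₂ r₁ r₂ : ℝ}

theorem transition_sub_one_div (hsum : lam + m₁ + m₂ = 1) (f : ℕ → ℕ → ℝ) (d : ℝ) (a b : ℕ) :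
    transition lam m₁ m₂ (fun a b => (f a b - 1) / d) a b
      = (transition lam m₁ m₂ f a b - 1) / d := by
  simp only [transition]
  split_ifs <;> linear_combination (-1 / d) * hsum

theorem exists_mul_expBound_le_exitProb (hlam : 0 < lam) (hr₁ : 1 < r₁) (hr₂ : 1 < r₂)
    (h₁ : m₁ = r₁ * lam) (h₂ : m₂ = r₂ * lam) (hsum : lam + m₁ + m₂ = 1) :
    ∃ κ : ℝ, 0 < κ ∧ ∀ n a b : ℕ, a + b ≠ 0 → a + b ≤ n →
      κ * expBound r₁ r₂ n a b ≤ exitProb lam m₁ m₂ n ![a, b] := by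
  have hm₁ : lam < m₁ := by rw [h₁]; nlinarith
  have hm₂ : lam < m₂ := by rw [h₂]; nlinarith
  have h0 := hlam.le
  have hm₁0 : 0 ≤ m₁ := by linarith
  have hm₂0 : 0 ≤ m₂ := by linarith
  have hk₁ : 0 < 1 - 1 / r₁ := by rw [sub_pos, div_lt_one] <;> linarith
  have hk₂ : 0 < 1 - 1 / r₂ := by rw [sub_pos, div_lt_one] <;> linarith
  have hk₁' : 1 - 1 / r₁ ≤ 1 := by have : 0 < 1 / r₁ := by positivity
                                   linarith
  have hU0 : ∀ n x, 0 ≤ exitProb lam m₁ m₂ n x := fun n x => measureReal_nonneg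
  -- Subtracting `1` gives the value `0` at the origin, as the exit probability requires; dividing
  -- by `d` keeps the values at most `1` on the exit line.
  have compare : ∀ (n : ℕ) (f : ℕ → ℕ → ℝ) (d : ℝ), 0 < d → f 0 0 = 1 →
      (∀ a b, f a b ≤ transition lam m₁ m₂ f a b) → (∀ a b, a + b = n → f a b ≤ d) →
      ∀ a b, n ≠ 0 → a + b ≤ n → (f a b - 1) / d ≤ exitProb lam m₁ m₂ n ![a, b] := by
    intro n f d hd hf0 hf hfn a b hn0 hab
    refine le_of_subharmonic_of_superharmonic hlam hm₁ hm₂ hsum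
      (f := fun a b => (f a b - 1) / d) (g := fun a b => exitProb lam m₁ m₂ n ![a, b])
      (fun a b _ _ => ?_) (fun a b h1 h2 => ?_) ?_ (fun a b h => ?_) hab
    · rw [transition_sub_one_div hsum]
      have := hf a b
      gcongr
    · exact (exitProb_eq_transition h0 hm₁0 hm₂0 hsum h1 h2).ge
    · rw [hf0, sub_self, zero_div]
      exact hU0 _ _
    · rw [exitProb_eq_one h0 hm₁0 hm₂0 hsum (by omega) h, div_le_one hd]
      linarith [hfn a b h]
  refine ⟨min (1 - 1 / r₂) (lam * (1 - 1 / r₁)), lt_min hk₂ (by positivity),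
    fun n a b hab hn => ?_⟩
  have hn0 : n ≠ 0 := by omega
  have hp₁ : 0 < r₁ ^ n := by positivity
  have hp₂ : 0 < r₂ ^ n := by positivity
  have hA : (1 - 1 / r₂) * (r₂ ^ (a + b) / r₂ ^ n) ≤ exitProb lam m₁ m₂ n ![a, b] := by
    refine le_trans ?_ (compare n (fun a b => r₂ ^ (a + b)) (r₂ ^ n) hp₂ (by simp) (fun a b => ?_)
      (fun a b h => by rw [h]) a b hn0 hn)
    · rw [← mul_div_assoc]
      have := pow_sub_one_ge hr₂ hab
      gcongr
    · rw [transition_pow_add h₂ hsum]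
      have : 0 ≤ (m₂ - lam) * r₂ ^ (a + b) := mul_nonneg (by linarith) (by positivity)
      split_ifs <;> linarith
  have hB' : ∀ a b : ℕ, a ≠ 0 → a + b ≤ n →
      (1 - 1 / r₁) * (r₁ ^ a / r₁ ^ n) ≤ exitProb lam m₁ m₂ n ![a, b] := by
    intro a b ha hab
    refine le_trans ?_ (compare n (fun a b => r₁ ^ a) (r₁ ^ n) hp₁ (by simp) (fun a b => ?_)
      (fun a b h => pow_le_pow_right₀ hr₁.le (by omega)) a b hn0 hab)
    · rw [← mul_div_assoc]
      have := pow_sub_one_ge hr₁ ha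
      gcongr
    · rw [transition_pow_left h₁ hsum]
      have : 0 ≤ (m₁ - lam) * r₁ ^ a := mul_nonneg (by linarith) (by positivity)
      split_ifs <;> linarith
  have hB : lam * (1 - 1 / r₁) * (r₁ ^ a / r₁ ^ n) ≤ exitProb lam m₁ m₂ n ![a, b] := by
    have hl1 : lam ≤ 1 := by linarith
    have hq : 0 ≤ r₁ ^ a / r₁ ^ n := by positivity
    rcases hn.eq_or_lt with h | h
    · rw [exitProb_eq_one h0 hm₁0 hm₂0 hsum hab h]
      have := pow_div_pow_le_one hr₁ (by omega : a ≤ n)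
      have := mul_le_one₀ hl1 hk₁.le hk₁'
      exact mul_le_one₀ this hq (by assumption)
    -- The comparison function `r₁ ^ a - 1` vanishes on `a = 0`. One arrival, of probability `λ`,
    -- moves the walk to `a = 1`, which explains the factor `λ` in the constant.
    rcases Nat.eq_zero_or_pos a with rfl | ha
    · rw [exitProb_eq_transition h0 hm₁0 hm₂0 hsum hab h, transition]
      have e1 := hB' 1 b one_ne_zero (by omega)
      have e2 : r₁ ^ 0 / r₁ ^ n ≤ r₁ ^ 1 / r₁ ^ n := by
        gcongr
        · exact hr₁.le
        · norm_num
      calc lam * (1 - 1 / r₁) * (r₁ ^ 0 / r₁ ^ n)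
          ≤ lam * ((1 - 1 / r₁) * (r₁ ^ 1 / r₁ ^ n)) := by
            rw [mul_assoc]; gcongr
        _ ≤ lam * exitProb lam m₁ m₂ n ![((0 + 1 : ℕ) : ℤ), b] := by
            gcongr
        _ ≤ _ := by
            rw [add_assoc]
            refine le_add_of_nonneg_right (add_nonneg ?_ ?_)
            · refine mul_nonneg hm₁0 ?_
              split_ifs <;> exact hU0 _ _
            · refine mul_nonneg hm₂0 ?_
              split_ifs <;> exact hU0 _ _
    · refine le_trans ?_ (hB' a b ha.ne' hn)
      rw [mul_assoc]
      exact mul_le_of_le_one_left (by positivity) hl1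
  have hp : 0 ≤ r₂ ^ (a + b) / r₂ ^ n := by positivity
  have hq : 0 ≤ r₁ ^ a / r₁ ^ n := by positivity
  unfold expBound
  rcases max_cases (r₂ ^ (a + b) / r₂ ^ n) (r₁ ^ a / r₁ ^ n) with ⟨h, -⟩ | ⟨h, -⟩ <;> rw [h]
  · exact (mul_le_mul_of_nonneg_right (min_le_left _ _) hp).trans hA
  · exact (mul_le_mul_of_nonneg_right (min_le_right _ _) hq).trans hB

/-- With `k = n - a - b`, the bracket is `(r₂ ^ (-k) - r₁ ^ (-k)) / r₁ ^ b`, which has the sign of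
`r₁ - r₂`, hence of the coefficient. Nonnegativity keeps the upper barrier above `1` on the exit
line. -/
theorem correction_nonneg (hlam : 0 < lam) (hr₁ : 1 < r₁) (hr₂ : 1 < r₂)
    (h₁ : m₁ = r₁ * lam) (h₂ : m₂ = r₂ * lam) {n a b : ℕ} (hn : a + b ≤ n) :
    0 ≤ (m₂ - lam) / (m₁ - m₂) * (r₂ ^ (a + b) / r₁ ^ b / r₂ ^ n - r₁ ^ a / r₁ ^ n) := by
  obtain ⟨k, rfl⟩ := Nat.exists_eq_add_of_le hn
  have hm₂ : lam < m₂ := by rw [h₂]; nlinarith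
  have e : r₂ ^ (a + b) / r₁ ^ b / r₂ ^ (a + b + k) - r₁ ^ a / r₁ ^ (a + b + k)
      = (1 / r₁ ^ b) * (1 / r₂ ^ k - 1 / r₁ ^ k) := by
    simp only [pow_add]
    field_simp
  rw [e]
  have hb : 0 ≤ 1 / r₁ ^ b := by positivity
  rcases le_total r₁ r₂ with h | h
  · have h3 : m₁ - m₂ ≤ 0 := by rw [h₁, h₂]; nlinarith
    have h4 : 1 / r₂ ^ k ≤ 1 / r₁ ^ k := by gcongr
    exact mul_nonneg_of_nonpos_of_nonpos (div_nonpos_of_nonneg_of_nonpos (by linarith) h3)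
      (mul_nonpos_of_nonneg_of_nonpos hb (by linarith))
  · have h3 : 0 ≤ m₁ - m₂ := by rw [h₁, h₂]; nlinarith
    have h4 : 1 / r₁ ^ k ≤ 1 / r₂ ^ k := by gcongr
    exact mul_nonneg (div_nonneg (by linarith) h3) (mul_nonneg hb (by linarith))

theorem correction_le (hr₁ : 1 < r₁) (hr₂ : 1 < r₂) {n a b : ℕ} :
    (m₂ - lam) / (m₁ - m₂) * (r₂ ^ (a + b) / r₁ ^ b / r₂ ^ n - r₁ ^ a / r₁ ^ n)
      ≤ |(m₂ - lam) / (m₁ - m₂)| * expBound r₁ r₂ n a b := by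
  set c := (m₂ - lam) / (m₁ - m₂)
  have hC : r₂ ^ (a + b) / r₁ ^ b / r₂ ^ n ≤ r₂ ^ (a + b) / r₂ ^ n := by
    gcongr
    exact div_le_self (by positivity) (one_le_pow₀ hr₁.le)
  have hC0 : 0 ≤ r₂ ^ (a + b) / r₁ ^ b / r₂ ^ n := by positivity
  have hB0 : 0 ≤ r₁ ^ a / r₁ ^ n := by positivity
  have h1 : r₂ ^ (a + b) / r₂ ^ n ≤ expBound r₁ r₂ n a b := le_max_left _ _
  have h2 : r₁ ^ a / r₁ ^ n ≤ expBound r₁ r₂ n a b := le_max_right _ _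
  refine (le_abs_self _).trans ?_
  rw [abs_mul]
  gcongr
  exact abs_sub_le_of_nonneg_of_le hC0 (hC.trans h1) hB0 h2

/-- The bound must not depend on `b`. If `r₁ ≤ r₂` the coefficient is nonpositive, and the term that
may grow with `b` has the favourable sign; if `r₂ ≤ r₁` that term is at most `r₂ ^ (-n)`. -/
theorem correction_le_left (hlam : 0 < lam) (hr₁ : 1 < r₁) (hr₂ : 1 < r₂)
    (h₁ : m₁ = r₁ * lam) (h₂ : m₂ = r₂ * lam) {n b : ℕ} :
    (m₂ - lam) / (m₁ - m₂) * (r₂ ^ (0 + b) / r₁ ^ b / r₂ ^ n - r₁ ^ 0 / r₁ ^ n)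
      ≤ |(m₂ - lam) / (m₁ - m₂)| * expBound r₁ r₂ n 0 0 := by
  have hm₂ : lam < m₂ := by rw [h₂]; nlinarith
  have hC0 : 0 ≤ r₂ ^ (0 + b) / r₁ ^ b / r₂ ^ n := by positivity
  have hB0 : 0 ≤ r₁ ^ 0 / r₁ ^ n := by positivity
  have e1 : r₂ ^ 0 / r₂ ^ n ≤ expBound r₁ r₂ n 0 0 := le_max_left _ _
  have e2 : r₁ ^ 0 / r₁ ^ n ≤ expBound r₁ r₂ n 0 0 := le_max_right _ _
  rcases le_total r₁ r₂ with h | h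
  · have h3 : m₁ - m₂ ≤ 0 := by rw [h₁, h₂]; nlinarith
    have h4 := div_nonpos_of_nonneg_of_nonpos (by linarith : 0 ≤ m₂ - lam) h3
    rw [abs_of_nonpos h4]
    set c := (m₂ - lam) / (m₁ - m₂)
    have := mul_nonneg (neg_nonneg.2 h4) hC0
    have := mul_le_mul_of_nonneg_left e2 (neg_nonneg.2 h4)
    linarith
  · have h3 : 0 ≤ m₁ - m₂ := by rw [h₁, h₂]; nlinarith
    have h4 := div_nonneg (by linarith : 0 ≤ m₂ - lam) h3
    rw [abs_of_nonneg h4]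
    have e3 : r₂ ^ (0 + b) / r₁ ^ b / r₂ ^ n ≤ r₂ ^ 0 / r₂ ^ n := by
      rw [zero_add, pow_zero]
      gcongr
      exact div_le_one_of_le₀ (by gcongr) (by positivity)
    gcongr
    linarith

theorem exists_exitProb_le_mul_expBound (hlam : 0 < lam) (hr₁ : 1 < r₁) (hr₂ : 1 < r₂)
    (h₁ : m₁ = r₁ * lam) (h₂ : m₂ = r₂ * lam) (hne : m₁ ≠ m₂) (hsum : lam + m₁ + m₂ = 1) :
    ∃ K : ℝ, 0 < K ∧ ∀ n a b : ℕ, n ≠ 0 → a + b ≤ n →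
      exitProb lam m₁ m₂ n ![a, b] ≤ K * (n : ℝ) ^ 2 * expBound r₁ r₂ n a b := by
  have hm₁ : lam < m₁ := by rw [h₁]; nlinarith
  have hm₂ : lam < m₂ := by rw [h₂]; nlinarith
  have h0 := hlam.le
  have hm₁0 : 0 ≤ m₁ := by linarith
  have hm₂0 : 0 ≤ m₂ := by linarith
  obtain ⟨G, K, hK, hG0, hG, hGK⟩ := exists_lyapunov hlam hm₁ hm₂ hsum
  obtain ⟨c, hc⟩ : ∃ c, c = (m₂ - lam) / (m₁ - m₂) := ⟨_, rfl⟩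
  have hcm : c * (m₁ - m₂) = m₂ - lam := by
    rw [hc]
    exact div_mul_cancel₀ _ (sub_ne_zero.2 hne)
  have hd : 0 < m₁ - lam := by linarith
  refine ⟨1 + |c| + (m₁ - lam) * |c| * K, by positivity, fun n a b hn0 hab => ?_⟩
  have hpos : ∀ a b, 0 < expBound r₁ r₂ n a b := fun a b => lt_max_of_lt_left (by positivity)
  -- `D` dominates the defect `(m₁ - lam) * E 0 b` for all `b`. Since it involves the bound at the
  -- origin, the smallest one, `D * G a b` costs only a factor of order `n ^ 2`.
  set D := (m₁ - lam) * (|c| * expBound r₁ r₂ n 0 0) with hD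
  have hD0 : 0 ≤ D := by
    have := (hpos 0 0).le
    positivity
  set E : ℕ → ℕ → ℝ := fun a b => c * (r₂ ^ (a + b) / r₁ ^ b / r₂ ^ n - r₁ ^ a / r₁ ^ n) with hE
  have hE0 : ∀ a b, a + b ≤ n → 0 ≤ E a b := fun a b h => by
    simp only [hE, hc]
    exact correction_nonneg hlam hr₁ hr₂ h₁ h₂ h
  have hE1 : ∀ a b, E a b ≤ |c| * expBound r₁ r₂ n a b := fun a b => by
    simp only [hE, hc]
    exact correction_le hr₁ hr₂
  have hE2 : ∀ b, E 0 b ≤ |c| * expBound r₁ r₂ n 0 0 := fun b => by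
    simp only [hE, hc]
    exact correction_le_left hlam hr₁ hr₂ h₁ h₂
  have main : exitProb lam m₁ m₂ n ![a, b] ≤ r₂ ^ (a + b) / r₂ ^ n + E a b + D * G a b := by
    refine le_of_subharmonic_of_superharmonic hlam hm₁ hm₂ hsum (n := n)
      (f := fun a b => exitProb lam m₁ m₂ n ![a, b])
      (g := fun a b => r₂ ^ (a + b) / r₂ ^ n + E a b + D * G a b)
      (fun a b h1 h2 => ?_) (fun a b h1 h2 => ?_) ?_ (fun a b h => ?_) hab
    · exact (exitProb_eq_transition h0 hm₁0 hm₂0 hsum h1 h2).le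
    · have e1 := transition_pow_add h₂ hsum a b
      have e2 := transition_pow_left h₁ hsum a b
      have e3 := transition_pow_mul_div_pow (by linarith) h₁ h₂ hsum h1
      have e4 : transition lam m₁ m₂ (fun a b => r₂ ^ (a + b) / r₂ ^ n + E a b + D * G a b) a b
          = transition lam m₁ m₂ (fun a b => r₂ ^ (a + b)) a b / r₂ ^ n
          + c * (transition lam m₁ m₂ (fun a b => r₂ ^ (a + b) / r₁ ^ b) a b / r₂ ^ n
            - transition lam m₁ m₂ (fun a _ => r₁ ^ a) a b / r₁ ^ n)
          + D * transition lam m₁ m₂ G a b := by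
        simp only [transition, hE]
        split_ifs <;> ring
      have e5 := mul_le_mul_of_nonneg_left (hG a b h1) hD0
      have e6 : transition lam m₁ m₂ (fun a b => r₂ ^ (a + b)) a b / r₂ ^ n
          + c * (transition lam m₁ m₂ (fun a b => r₂ ^ (a + b) / r₁ ^ b) a b / r₂ ^ n
            - transition lam m₁ m₂ (fun a _ => r₁ ^ a) a b / r₁ ^ n)
          = r₂ ^ (a + b) / r₂ ^ n + E a b + if a = 0 then (m₁ - lam) * E a b else 0 := by
        rw [e1, e2, e3]
        simp only [hE]
        split_ifs with hb ha ha
        · omega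
        · subst hb
          simp only [pow_zero, div_one]
          -- On `b = 0` the defects `m₂ - lam` and `c * (m₂ - m₁)` cancel, by the choice of `c`.
          linear_combination (-(r₂ ^ (a + 0) / r₂ ^ n)) * hcm
        · ring
        · ring
      have e7 : (if a = 0 then (m₁ - lam) * E a b else 0) ≤ D := by
        split_ifs with ha
        · subst ha
          exact mul_le_mul_of_nonneg_left (hE2 b) hd.le
        · exact hD0
      rw [e4, e6]
      linarith
    · have := exitProb_zero (lam := lam) (m₁ := m₁) (m₂ := m₂) n
      have e : (![((0 : ℕ) : ℤ), ((0 : ℕ) : ℤ)] : Fin 2 → ℤ) = 0 := by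
        ext i; fin_cases i <;> rfl
      simp only [e, this]
      have := hE0 0 0 (Nat.zero_le _)
      have := mul_nonneg hD0 (hG0 0 0)
      positivity
    · have e1 := hE0 a b h.le
      have e2 := mul_nonneg hD0 (hG0 a b)
      rw [exitProb_eq_one h0 hm₁0 hm₂0 hsum (by omega) h, h, div_self (by positivity)]
      linarith
  have hn1 : (1 : ℝ) ≤ (n : ℝ) ^ 2 :=
    one_le_pow₀ (by exact_mod_cast Nat.one_le_iff_ne_zero.2 hn0)
  have hX := hpos a b
  have hmono : expBound r₁ r₂ n 0 0 ≤ expBound r₁ r₂ n a b := by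
    unfold expBound
    apply max_le_max
    · have : r₂ ^ (0 + 0) ≤ r₂ ^ (a + b) := pow_le_pow_right₀ hr₂.le (by omega)
      gcongr
    · have : r₁ ^ 0 ≤ r₁ ^ a := pow_le_pow_right₀ hr₁.le (by omega)
      gcongr
  have hA : r₂ ^ (a + b) / r₂ ^ n ≤ expBound r₁ r₂ n a b := le_max_left _ _
  have hDG : D * G a b ≤ (m₁ - lam) * (|c| * expBound r₁ r₂ n a b) * (K * (n : ℝ) ^ 2) := by
    have := hGK n a b hn0 hab
    have := hG0 a b
    rw [hD]
    gcongr
  have hfin : (1 + |c|) * expBound r₁ r₂ n a b ≤ (1 + |c|) * expBound r₁ r₂ n a b * (n : ℝ) ^ 2 :=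
    le_mul_of_one_le_right (by positivity) hn1
  have := hE1 a b
  calc exitProb lam m₁ m₂ n ![a, b]
      ≤ (1 + |c|) * expBound r₁ r₂ n a b
        + (m₁ - lam) * (|c| * expBound r₁ r₂ n a b) * (K * (n : ℝ) ^ 2) := by linarith
    _ ≤ (1 + |c|) * expBound r₁ r₂ n a b * (n : ℝ) ^ 2
        + (m₁ - lam) * (|c| * expBound r₁ r₂ n a b) * (K * (n : ℝ) ^ 2) := by linarith
    _ = _ := by ring

end Bounds

/-! ### Passage to the exponential rate -/

theorem scaledStart_eq (n : ℕ) {x : EuclideanSpace ℝ (Fin 2)} (hx : ∀ i, 0 ≤ x i) :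
    scaledStart n x = ![((⌊x 0 * n⌋₊ : ℕ) : ℤ), ((⌊x 1 * n⌋₊ : ℕ) : ℤ)] := by
  ext i
  have h : scaledStart n x i = ((⌊x i * n⌋₊ : ℕ) : ℤ) := by
    rw [scaledStart, mul_comm, Int.natCast_floor_eq_floor]
    exact mul_nonneg (hx i) n.cast_nonneg
  fin_cases i <;> exact h

theorem log_expBound {r₁ r₂ : ℝ} (hr₁ : 1 < r₁) (hr₂ : 1 < r₂) (n a b : ℕ) :
    Real.log (expBound r₁ r₂ n a b)
      = -min (Real.log r₂ * (n - a - b)) (Real.log r₁ * (n - a)) := by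
  have e2 : Real.log (r₂ ^ (a + b) / r₂ ^ n) = -(Real.log r₂ * (n - a - b)) := by
    rw [Real.log_div (by positivity) (by positivity), Real.log_pow, Real.log_pow]
    push_cast
    ring
  have e1 : Real.log (r₁ ^ a / r₁ ^ n) = -(Real.log r₁ * (n - a)) := by
    rw [Real.log_div (by positivity) (by positivity), Real.log_pow, Real.log_pow]
    ring
  have hA : 0 < r₂ ^ (a + b) / r₂ ^ n := by positivity
  have hB : 0 < r₁ ^ a / r₁ ^ n := by positivity
  rw [← max_neg_neg, ← e1, ← e2, expBound]
  rcases le_total (r₂ ^ (a + b) / r₂ ^ n) (r₁ ^ a / r₁ ^ n) with h | h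
  · rw [max_eq_right h, max_eq_right (Real.log_le_log hA h)]
  · rw [max_eq_left h, max_eq_left (Real.log_le_log hB h)]

theorem rate_eq_min {ρ₁ ρ₂ : ℝ} (h₁ : 0 < ρ₁) (h₁' : ρ₁ < 1) (h₂ : 0 < ρ₂) (h₂' : ρ₂ < 1)
    {x : EuclideanSpace ℝ (Fin 2)} (hx : ∀ i, 0 ≤ x i) (hx_lt : x 0 + x 1 < 1) :
    rate ρ₁ ρ₂ x
      = min (-Real.log ρ₂ * (1 - x 0 - x 1)) (-Real.log ρ₁ * (1 - x 0)) := by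
  have e1 : inner ℝ (r₁ ρ₁ ρ₂) x = max (Real.log ρ₁) (Real.log ρ₂) * x 0 := by
    simp [r₁, gam, inner_smul_left, PiLp.inner_apply, Fin.sum_univ_two]
  have e2 : inner ℝ (r₃ ρ₂) x = Real.log ρ₂ * (x 0 + x 1) := by
    simp [r₃, inner_smul_left, PiLp.inner_apply, Fin.sum_univ_two]
  rw [rate, e1, e2, min_comm]
  have l1 := Real.log_neg h₁ h₁'
  have l2 := Real.log_neg h₂ h₂'
  have h0 := hx 0
  have h1 := hx 1
  rcases le_total (Real.log ρ₁) (Real.log ρ₂) with h | h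
  -- Here `γ = -log ρ₂`, and the `ρ₁` terms of the two minima differ; neither matters, because the
  -- `ρ₂` term is the smaller one in both. In the other case the terms agree one by one.
  · rw [max_eq_right h, min_eq_left, min_eq_left] <;> nlinarith
  · rw [max_eq_left h]
    congr 1 <;> ring

/-- The constants and the factor `n ^ 2` contribute `O(1 / n)` and `2 log n / n`, both of which tend
to `0`. -/
theorem tendsto_neg_log_div_of_bounds {u m : ℕ → ℝ} {κ K l : ℝ} (hκ : 0 < κ) (hK : 0 < K)
    (hm : ∀ n, 0 < m n) (hlow : ∀ᶠ n in atTop, κ * m n ≤ u n)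
    (hup : ∀ᶠ n : ℕ in atTop, u n ≤ K * (n : ℝ) ^ 2 * m n)
    (hlim : Tendsto (fun n : ℕ => -(1 / (n : ℝ)) * Real.log (m n)) atTop (𝓝 l)) :
    Tendsto (fun n : ℕ => -(1 / (n : ℝ)) * Real.log (u n)) atTop (𝓝 l) := by
  have hinv : Tendsto (fun n : ℕ => 1 / (n : ℝ)) atTop (𝓝 0) := tendsto_one_div_atTop_nhds_zero_nat
  have hlog : Tendsto (fun n : ℕ => 1 / (n : ℝ) * Real.log n) atTop (𝓝 0) := by
    have := (Real.isLittleO_log_id_atTop.tendsto_div_nhds_zero).comp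
      (tendsto_natCast_atTop_atTop (R := ℝ))
    refine this.congr fun n => ?_
    simp only [Function.comp, id]
    ring
  have t1 : Tendsto (fun n : ℕ => -(1 / (n : ℝ)) * Real.log (m n)
      - (1 / (n : ℝ)) * Real.log κ) atTop (𝓝 l) := by
    simpa using hlim.sub (hinv.mul_const (Real.log κ))
  have t2 : Tendsto (fun n : ℕ => -(1 / (n : ℝ)) * Real.log (m n)
      - (1 / (n : ℝ)) * Real.log K - 2 * (1 / (n : ℝ) * Real.log n)) atTop (𝓝 l) := by
    simpa using (hlim.sub (hinv.mul_const (Real.log K))).sub (hlog.const_mul 2)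
  refine tendsto_of_tendsto_of_tendsto_of_le_of_le' t2 t1 ?_ ?_
  · filter_upwards [hlow, hup, eventually_gt_atTop 0] with n h1 h2 h3
    have hn : (0 : ℝ) < n := by exact_mod_cast h3
    have hu : 0 < u n := (mul_pos hκ (hm n)).trans_le h1
    have h4 := Real.log_le_log hu h2
    rw [Real.log_mul (by positivity) (hm n).ne', Real.log_mul hK.ne' (by positivity),
      Real.log_pow] at h4
    have h5 := mul_le_mul_of_nonneg_left h4 (by positivity : 0 ≤ 1 / (n : ℝ))
    push_cast at h5
    linarith
  · filter_upwards [hlow, eventually_gt_atTop 0] with n h1 h3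
    have hn : (0 : ℝ) < n := by exact_mod_cast h3
    have h4 := Real.log_le_log (mul_pos hκ (hm n)) h1
    rw [Real.log_mul hκ.ne' (hm n).ne'] at h4
    have h5 := mul_le_mul_of_nonneg_left h4 (by positivity : 0 ≤ 1 / (n : ℝ))
    linarith

theorem tendsto_log_expBound {r₁ r₂ : ℝ} (hr₁ : 1 < r₁) (hr₂ : 1 < r₂) {a b : ℕ → ℕ} {s t : ℝ}
    (ha : Tendsto (fun n => (a n : ℝ) / n) atTop (𝓝 s))
    (hb : Tendsto (fun n => (b n : ℝ) / n) atTop (𝓝 t)) :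
    Tendsto (fun n : ℕ => -(1 / (n : ℝ)) * Real.log (expBound r₁ r₂ n (a n) (b n))) atTop
      (𝓝 (min (Real.log r₂ * (1 - s - t)) (Real.log r₁ * (1 - s)))) := by
  have h := (((ha.const_sub 1).sub hb).const_mul (Real.log r₂)).min
    ((ha.const_sub 1).const_mul (Real.log r₁))
  refine h.congr' ?_
  filter_upwards [eventually_gt_atTop 0] with n hn
  have hn' : (0 : ℝ) < n := by exact_mod_cast hn
  rw [log_expBound hr₁ hr₂, neg_mul_neg, mul_min_of_nonneg _ _ (by positivity)]
  congr 1 <;> field_simp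

end TandemQueue

theorem mainTheorem5
    (lam m₁ m₂ : ℝ) (hlam : 0 < lam) (hm₁ : lam < m₁) (hm₂ : lam < m₂) (hne : m₁ ≠ m₂)
    (hsum : lam + m₁ + m₂ = 1)
    {Ω : Type*} [MeasurableSpace Ω] (P : Measure Ω) [IsProbabilityMeasure P]
    (I : ℕ → Ω → (Fin 2 → ℤ))
    (hindep : iIndepFun I P)
    (hlaw : ∀ k, HasLaw (I k) (TandemQueue.stepLaw lam m₁ m₂) P)
    (x : EuclideanSpace ℝ (Fin 2)) (hx : ∀ i, 0 ≤ x i)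
    (hx_pos : 0 < x 0 + x 1) (hx_lt : x 0 + x 1 < 1) :
    Tendsto
      (fun n : ℕ => -(1 / (n : ℝ)) *
        Real.log (P.real {ω | TandemQueue.exitTime I (TandemQueue.scaledStart n x) n ω
          < TandemQueue.emptyTime I (TandemQueue.scaledStart n x) ω}))
      atTop (𝓝 (TandemQueue.rate (lam / m₁) (lam / m₂) x)) := by
  have hm₁0 : 0 < m₁ := hlam.trans hm₁
  have hm₂0 : 0 < m₂ := hlam.trans hm₂
  have hr₁ : 1 < m₁ / lam := (one_lt_div hlam).2 hm₁
  have hr₂ : 1 < m₂ / lam := (one_lt_div hlam).2 hm₂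
  have h₁ : m₁ = m₁ / lam * lam := (div_mul_cancel₀ _ hlam.ne').symm
  have h₂ : m₂ = m₂ / lam * lam := (div_mul_cancel₀ _ hlam.ne').symm
  obtain ⟨κ, hκ, hlow⟩ :=
    TandemQueue.exists_mul_expBound_le_exitProb hlam hr₁ hr₂ h₁ h₂ hsum
  obtain ⟨K, hK, hup⟩ :=
    TandemQueue.exists_exitProb_le_mul_expBound hlam hr₁ hr₂ h₁ h₂ hne hsum
  have hfloor : ∀ i, Tendsto (fun n : ℕ => (⌊x i * n⌋₊ : ℝ) / n) atTop (𝓝 (x i)) := fun i =>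
    (tendsto_nat_floor_mul_div_atTop (hx i)).comp tendsto_natCast_atTop_atTop
  have hle : ∀ n : ℕ, ⌊x 0 * n⌋₊ + ⌊x 1 * n⌋₊ ≤ n := fun n => by
    have e0 := Nat.floor_le (mul_nonneg (hx 0) n.cast_nonneg)
    have e1 := Nat.floor_le (mul_nonneg (hx 1) n.cast_nonneg)
    have e2 := mul_le_mul_of_nonneg_right hx_lt.le (n.cast_nonneg (α := ℝ))
    have : ((⌊x 0 * n⌋₊ + ⌊x 1 * n⌋₊ : ℕ) : ℝ) ≤ n := by
      push_cast
      linarith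
    exact_mod_cast this
  have hne0 : ∀ᶠ n : ℕ in atTop, ⌊x 0 * n⌋₊ + ⌊x 1 * n⌋₊ ≠ 0 := by
    filter_upwards [((hfloor 0).add (hfloor 1)).eventually_const_lt hx_pos] with n hn h
    obtain ⟨e0, e1⟩ : ⌊x 0 * n⌋₊ = 0 ∧ ⌊x 1 * n⌋₊ = 0 := by omega
    simp [e0, e1] at hn
  have hrate : TandemQueue.rate (lam / m₁) (lam / m₂) x
      = min (Real.log (m₂ / lam) * (1 - x 0 - x 1)) (Real.log (m₁ / lam) * (1 - x 0)) := by
    rw [TandemQueue.rate_eq_min (by positivity) ((div_lt_one hm₁0).2 hm₁) (by positivity)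
      ((div_lt_one hm₂0).2 hm₂) hx hx_lt, ← Real.log_inv, ← Real.log_inv, inv_div, inv_div]
  rw [hrate]
  simp only [TandemQueue.measureReal_exitTime_lt_emptyTime P hindep hlaw,
    TandemQueue.scaledStart_eq _ hx]
  refine TandemQueue.tendsto_neg_log_div_of_bounds hκ hK
    (m := fun n => TandemQueue.expBound (m₁ / lam) (m₂ / lam) n ⌊x 0 * n⌋₊ ⌊x 1 * n⌋₊)
    (fun n => lt_max_of_lt_left (by positivity)) ?_ ?_
    (TandemQueue.tendsto_log_expBound hr₁ hr₂ (hfloor 0) (hfloor 1))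
  · filter_upwards [hne0] with n hn
    exact hlow n _ _ hn (hle n)
  · filter_upwards [eventually_ne_atTop 0] with n hn
    exact hup n _ _ hn (hle n)
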